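/- Let $n$ be a positive integer and fix a real number $\kappa\in(0,n]$. For $\mathbf{x},\mathbf{y}\in\mathbb{R}^n$ write $\mathbf{x}\le\mathbf{y}$ if $x_i\le y_i$ for all $i\in\{1,\ldots,n\}$. A set $C\subset\mathbb{R}^n$ is called a chain if for all distinct $\mathbf{x},\mathbf{y}\in C$ we have $\mathbf{x}\le\mathbf{y}$ or $\mathbf{y}\le\mathbf{x}$. Let $\mathcal{H}^1$ denote one-dimensional Hausdorff outer measure on $\mathbb{R}^n$ with the Euclidean distance, and $\mathcal{L}^n$ the $n$-dimensional Lebesgue measure. Let $A\subset[0,1]^n$ be a Lebesgue measurable set such that $$\mathcal{H}^1(A\cap C)\le\kappa\quad\text{for all chains } C\subset[0,1]^n. \tag{1}$$ Then $$\mathcal{L}^n(A)\le\mathcal{L}^n(A^*_\kappa),\qquad A^*_\kappa:=\Big\{(x_1,\ldots,x_n)\in[0,1]^n:\ \frac{n-\kappa}{2}\le\sum_{i=1}^n x_i\le\frac{n+\kappa}{2}\Big\}.$$ The set $A^*_\kappa$ is optimal, that is, it is itself Lebesgue measurable and satisfies (1) in place of $A$. Moreover, $$\mathcal{L}^n(A^*_\kappa)=v_n(\kappa):=1-\frac{2}{n!}\sum_{j=0}^{\lfloor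 (n-\kappa)/2\rfloor}(-1)^j\binom{n}{j}\Big(\frac{n-\kappa}{2}-j\Big)^n .$$ -/

import Mathlib

open MeasureTheory

noncomputable section

/-- The unit `n`-cube `[0,1]^n` in Euclidean space. -/
def unitCube (n : ℕ) : Set (EuclideanSpace ℝ (Fin n)) :=
  {x | ∀ i, 0 ≤ x i ∧ x i ≤ 1}

/-- A chain in `ℝ^n`: any two distinct points are comparable in the coordinatewise order. -/
def IsCoordChain {n : ℕ} (C : Set (EuclideanSpace ℝ (Fin n))) : Prop :=
  IsChain (fun x y : EuclideanSpace ℝ (Fin n) => ∀ i, x i ≤ y i) C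

/-- The Lebesgue-measurable subsets of the unit cube that meet every chain of the unit cube
(measurable or not) in a set of one-dimensional Hausdorff outer measure at most `κ`.
Lebesgue measurability is `NullMeasurableSet` with respect to `volume`. -/
structure IsContSperner (n : ℕ) (κ : ℝ) (A : Set (EuclideanSpace ℝ (Fin n))) : Prop where
  subset_unitCube : A ⊆ unitCube n
  measurable : NullMeasurableSet A volume
  chain_le : ∀ C : Set (EuclideanSpace ℝ (Fin n)), C ⊆ unitCube n → IsCoordChain C →
    Measure.hausdorffMeasure 1 (A ∩ C) ≤ ENNReal.ofReal κ

/-- The closed central slab of the unit cube of width `κ` in the coordinate sum. -/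
def centralSlab (n : ℕ) (κ : ℝ) : Set (EuclideanSpace ℝ (Fin n)) :=
  {x | x ∈ unitCube n ∧ ((n : ℝ) - κ) / 2 ≤ ∑ i, x i ∧ ∑ i, x i ≤ ((n : ℝ) + κ) / 2}

/-- The number `v_n(κ)`, used for `0 < κ ≤ n`, where `(n - κ) / 2` is nonnegative. -/
def slabVolume (n : ℕ) (κ : ℝ) : ℝ :=
  1 - 2 / (n.factorial : ℝ) *
    ∑ j ∈ Finset.range (⌊((n : ℝ) - κ) / 2⌋₊ + 1),
      (-1 : ℝ) ^ j * (n.choose j : ℝ) * (((n : ℝ) - κ) / 2 - (j : ℝ)) ^ n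

end

/-! This is a continuous symmetric chain decomposition. The cube is foliated by monotone paths
parametrized by their coordinate sum `s` over intervals `[a, n - a]`, all centred at `n / 2`, and
Lebesgue measure disintegrates into `ds` along the leaves (`exists_symmPath_foliation`). Each leaf
is a chain on which `ds` is at most `ℋ¹`, so `A` occupies at most `min κ (n - 2a)` of it. The slab
occupies exactly that much, because its range of sums is centred at `n / 2` too. Integrating over
the leaves gives the bound.

The foliation is built by induction on the dimension: a leaf times `[0,1]` is a rectangle, which is
swept by L-shaped hooks that are again symmetric.

The slab is admissible because the coordinate sum, restricted to a chain, has a 1-Lipschitz inverse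
(`IsCoordChain.hausdorffMeasure_le`). Its volume is the cube minus two congruent corners, each given
by the Irwin–Hall distribution function. -/

/-! ### Slicing the cube, and sweeping a rectangle by hooks. -/

theorem setLIntegral_Icc_cons (n : ℕ) {f : (Fin (n + 1) → ℝ) → ENNReal} (hf : Measurable f) :
    ∫⁻ x in Set.Icc 0 1, f x =
      ∫⁻ y in Set.Icc (0 : ℝ) 1, ∫⁻ x in Set.Icc (0 : Fin n → ℝ) 1, f (Fin.cons y x) := by
  have he := (volume_preserving_piFinSuccAbove (fun _ : Fin (n + 1) => ℝ) 0).symm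
  have hpre : (MeasurableEquiv.piFinSuccAbove (fun _ : Fin (n + 1) => ℝ) 0).symm ⁻¹' Set.Icc 0 1 =
      Set.Icc (0 : ℝ) 1 ×ˢ Set.Icc (0 : Fin n → ℝ) 1 := by
    ext ⟨y, x⟩
    simp only [Set.mem_preimage, MeasurableEquiv.piFinSuccAbove_symm_apply, Fin.insertNthEquiv_zero,
      Set.mem_prod, Set.mem_Icc, Pi.le_def, Fin.forall_fin_succ]
    simp [Fin.consEquiv]
    tauto
  rw [← he.setLIntegral_comp_preimage_emb (MeasurableEquiv.measurableEmbedding _) f, hpre,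
    Measure.volume_eq_prod, setLIntegral_prod _ (by fun_prop)]
  simp [Fin.consEquiv]

theorem measurable_setLIntegral_Icc {α : Type*} [MeasurableSpace α] {l u : α → ℝ}
    (hl : Measurable l) (hu : Measurable u) {g : α × ℝ → ENNReal} (hg : Measurable g) :
    Measurable fun x => ∫⁻ s in Set.Icc (l x) (u x), g (x, s) := by
  have hE : MeasurableSet {p : α × ℝ | l p.1 ≤ p.2 ∧ p.2 ≤ u p.1} := by
    rw [Set.ofPred_and]
    exact (measurableSet_le (by fun_prop) (by fun_prop)).inter
      (measurableSet_le (by fun_prop) (by fun_prop))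
  have : ∀ x, ∫⁻ s in Set.Icc (l x) (u x), g (x, s) =
      ∫⁻ s, {p : α × ℝ | l p.1 ≤ p.2 ∧ p.2 ≤ u p.1}.indicator g (x, s) := by
    intro x
    rw [← lintegral_indicator measurableSet_Icc]
    rfl
  simp only [this]
  exact (hg.indicator hE).lintegral_prod_right'

/-- Hook `σ` runs at height `y = σ` from abscissa `a` to `b - σ`, then vertically up to `y = 1`; the
inner variable on the right is the sum of the two coordinates. Horizontal legs sweep the part of the
rectangle with abscissa at most `b - y`, vertical legs the rest. On each leg the change of variables
is a translation or a reflection, so no Jacobian appears. -/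
theorem lintegral_rectangle_eq_lintegral_hooks (a b : ℝ) {g : ℝ × ℝ → ENNReal} (hg : Measurable g) :
    ∫⁻ y in Set.Icc (0 : ℝ) 1, ∫⁻ s in Set.Icc a b, g (s, y) =
      ∫⁻ σ in Set.Icc 0 (min 1 (b - a)), ∫⁻ s in Set.Icc (a + σ) (b + 1 - σ),
        g (min (s - σ) (b - σ), max σ (s - b + σ)) := by
  have inner : ∀ σ ∈ Set.Icc (0 : ℝ) (min 1 (b - a)),
      ∫⁻ s in Set.Icc (a + σ) (b + 1 - σ), g (min (s - σ) (b - σ), max σ (s - b + σ)) =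
      (∫⁻ s in Set.Icc a (b - σ), g (s, σ)) + ∫⁻ y in Set.Ioc σ 1, g (b - σ, y) := by
    intro σ hσ
    simp only [Set.mem_Icc, le_min_iff] at hσ
    -- The corner of the hook is at parameter `b`.
    rw [← lintegral_inter_add_sdiff _ _ (measurableSet_Iic (a := b))]
    congr 1
    · rw [← lintegral_indicator (by measurability), ← lintegral_indicator (by measurability)]
      symm
      rw [← lintegral_sub_right_eq_self _ σ]
      symm
      congr 1 with s
      by_cases h : a + σ ≤ s ∧ s ≤ b
      · rw [Set.indicator_of_mem, Set.indicator_of_mem]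
        · congr 2
          · exact min_eq_left (by linarith)
          · exact max_eq_left (by linarith)
        · constructor <;> linarith
        · exact ⟨⟨h.1, by linarith⟩, h.2⟩
      · rw [Set.indicator_of_notMem, Set.indicator_of_notMem]
        · rintro ⟨h1, h2⟩
          exact h ⟨by linarith, by linarith⟩
        · rintro ⟨h1, h2⟩
          exact h ⟨h1.1, h2⟩
    · rw [← lintegral_indicator (by measurability), ← lintegral_indicator (by measurability)]
      symm
      rw [← lintegral_sub_right_eq_self _ (b - σ)]
      symm
      congr 1 with s
      by_cases h : b < s ∧ s ≤ b + 1 - σ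
      · rw [Set.indicator_of_mem, Set.indicator_of_mem]
        · congr 2
          · exact min_eq_right (by linarith)
          · rw [max_eq_right (by linarith)]
            ring
        · constructor <;> linarith
        · exact ⟨⟨by linarith, h.2⟩, fun h' => absurd h.1 (not_lt.2 h')⟩
      · rw [Set.indicator_of_notMem, Set.indicator_of_notMem]
        · rintro ⟨h1, h2⟩
          exact h ⟨by linarith, by linarith⟩
        · rintro ⟨h1, h2⟩
          exact h ⟨not_le.1 h2, h1.2⟩
  have hm1 : Measurable fun y => ∫⁻ s in Set.Icc a b ∩ Set.Iic (b - y), g (s, y) := by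
    have : ∀ y, Set.Icc a b ∩ Set.Iic (b - y) = Set.Icc a (min b (b - y)) := fun y => by
      ext s
      simp [and_assoc]
    simp only [this]
    exact measurable_setLIntegral_Icc measurable_const (by fun_prop) (hg.comp measurable_swap)
  have hm2 : Measurable fun σ => ∫⁻ s in Set.Icc a (b - σ), g (s, σ) :=
    measurable_setLIntegral_Icc measurable_const (by fun_prop) (hg.comp measurable_swap)
  rw [setLIntegral_congr_fun measurableSet_Icc inner, lintegral_add_left hm2]
  have split : ∀ y, ∫⁻ s in Set.Icc a b, g (s, y) =
      (∫⁻ s in Set.Icc a b ∩ Set.Iic (b - y), g (s, y)) +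
        ∫⁻ s in Set.Icc a b \ Set.Iic (b - y), g (s, y) := fun y =>
    (lintegral_inter_add_sdiff _ _ measurableSet_Iic).symm
  simp only [split]
  rw [lintegral_add_left hm1]
  congr 1
  · rw [← lintegral_indicator measurableSet_Icc, ← lintegral_indicator measurableSet_Icc]
    congr 1 with y
    by_cases h0 : y ∈ Set.Icc (0 : ℝ) 1
    · rw [Set.indicator_of_mem h0]
      have : Set.Icc a b ∩ Set.Iic (b - y) = Set.Icc a (b - y) := by
        ext s
        simp only [Set.mem_inter_iff, Set.mem_Icc, Set.mem_Iic]
        constructor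
        · rintro ⟨⟨_, _⟩, _⟩; constructor <;> linarith
        · rintro ⟨_, _⟩; refine ⟨⟨?_, ?_⟩, ?_⟩ <;> linarith [h0.1]
      rw [this]
      by_cases h : y ≤ b - a
      · rw [Set.indicator_of_mem (Set.mem_Icc.2 ⟨h0.1, le_min h0.2 h⟩)]
      · rw [Set.indicator_of_notMem fun h' => h (h'.2.trans (min_le_right _ _)),
          Set.Icc_eq_empty (by intro h'; apply h; linarith)]
        simp
    · rw [Set.indicator_of_notMem h0, Set.indicator_of_notMem]
      exact fun h' => h0 ⟨h'.1, h'.2.trans (min_le_left _ _)⟩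
  -- `D` is the part swept by vertical legs. With the abscissa outermost, reflecting it in `b` turns
  -- it into the hook label.
  · set D : Set (ℝ × ℝ) := {p | (0 ≤ p.2 ∧ p.2 ≤ 1) ∧ (a ≤ p.1 ∧ p.1 ≤ b) ∧ b - p.2 < p.1}
    have hD : MeasurableSet D := by
      simp only [D, Set.ofPred_and]
      exact ((measurableSet_le (by fun_prop) (by fun_prop)).inter
        (measurableSet_le (by fun_prop) (by fun_prop))).inter
        (((measurableSet_le (by fun_prop) (by fun_prop)).inter
        (measurableSet_le (by fun_prop) (by fun_prop))).inter
        (measurableSet_lt (by fun_prop) (by fun_prop)))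
    have h1 : ∫⁻ y in Set.Icc (0 : ℝ) 1, ∫⁻ s in Set.Icc a b \ Set.Iic (b - y), g (s, y) =
        ∫⁻ y, ∫⁻ s, D.indicator g (s, y) := by
      rw [← lintegral_indicator measurableSet_Icc]
      congr 1 with y
      by_cases h0 : y ∈ Set.Icc (0 : ℝ) 1
      · rw [Set.indicator_of_mem h0, ← lintegral_indicator (by measurability)]
        congr 1 with s
        simp [Set.indicator_apply, D, h0.1, h0.2]
      · rw [Set.indicator_of_notMem h0]
        have : ∀ s, D.indicator g (s, y) = 0 := fun s =>
          Set.indicator_of_notMem (fun h => h0 h.1) _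
        simp [this]
    rw [h1, lintegral_lintegral_swap (f := fun y s => D.indicator g (s, y))
      ((((hg.indicator hD).comp measurable_swap)).aemeasurable),
      ← lintegral_sub_left_eq_self _ b, ← lintegral_indicator measurableSet_Icc]
    congr 1 with σ
    by_cases h0 : σ ∈ Set.Icc 0 (min 1 (b - a))
    · rw [Set.indicator_of_mem h0, ← lintegral_indicator (by measurability)]
      rw [Set.mem_Icc, le_min_iff] at h0
      congr 1 with y
      simp only [Set.indicator_apply]
      congr 1
      simp only [D, Set.mem_ofPred_eq, Set.mem_Ioc, eq_iff_iff]
      constructor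
      · rintro ⟨⟨_, _⟩, ⟨_, _⟩, _⟩
        constructor <;> linarith
      · rintro ⟨_, _⟩
        refine ⟨⟨?_, ?_⟩, ⟨?_, ?_⟩, ?_⟩ <;> linarith
    · rw [Set.indicator_of_notMem h0]
      have : ∀ y, D.indicator g (b - σ, y) = 0 := by
        refine fun y => Set.indicator_of_notMem ?_ _
        rintro ⟨⟨h1, h2⟩, ⟨h3, h4⟩, h5⟩
        simp only at h1 h2 h3 h4 h5
        exact h0 ⟨by linarith, le_min (by linarith) (by linarith)⟩
      simp [this]

/-! ### Symmetric monotone paths and the foliation of the cube. -/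

/-- A monotone path in the cube, parametrized by the coordinate sum over the symmetric interval
`[a, n - a]`, whose images have one-dimensional Hausdorff measure at least the length. -/
structure IsSymmPath (n : ℕ) (a : ℝ) (γ : ℝ → Fin n → ℝ) : Prop where
  mapsTo : ∀ s ∈ Set.Icc a (n - a), γ s ∈ Set.Icc 0 1
  monotoneOn : MonotoneOn γ (Set.Icc a (n - a))
  sum_eq : ∀ s ∈ Set.Icc a (n - a), ∑ i, γ s i = s
  volume_le : ∀ S ⊆ Set.Icc a (n - a),
    volume S ≤ Measure.hausdorffMeasure 1 ((fun s => WithLp.toLp 2 (γ s)) '' S)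

/-- Follow `γ` up to height `b - σ` with first coordinate `σ`, then move the first coordinate. -/
def hook {n : ℕ} (b σ : ℝ) (γ : ℝ → Fin n → ℝ) (s : ℝ) : Fin (n + 1) → ℝ :=
  Fin.cons (max σ (s - b + σ)) (γ (min (s - σ) (b - σ)))

theorem isometry_toLp_cons_right {n : ℕ} (y : ℝ) :
    Isometry fun x : EuclideanSpace ℝ (Fin n) =>
      (WithLp.toLp 2 (Fin.cons y (WithLp.ofLp x) : Fin (n + 1) → ℝ) :
        EuclideanSpace ℝ (Fin (n + 1))) := by
  refine Isometry.of_dist_eq fun x x' => ?_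
  simp [EuclideanSpace.dist_eq, Fin.sum_univ_succ]

theorem isometry_toLp_cons_left {n : ℕ} (x : Fin n → ℝ) (c : ℝ) :
    Isometry fun y : ℝ =>
      (WithLp.toLp 2 (Fin.cons (y + c) x : Fin (n + 1) → ℝ) :
        EuclideanSpace ℝ (Fin (n + 1))) := by
  refine Isometry.of_dist_eq fun x x' => ?_
  simp [EuclideanSpace.dist_eq, Fin.sum_univ_succ, Real.sqrt_sq_eq_abs, Real.dist_eq]

theorem IsSymmPath.hook {n : ℕ} {a σ : ℝ} {γ : ℝ → Fin n → ℝ} (h : IsSymmPath n a γ)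
    (hσ : σ ∈ Set.Icc 0 (min 1 (n - a - a))) :
    IsSymmPath (n + 1) (a + σ) (hook (n - a) σ γ) := by
  simp only [Set.mem_Icc, le_min_iff] at hσ
  obtain ⟨h0, h1, h2⟩ := hσ
  have key : ∀ s ∈ Set.Icc (a + σ) (((n + 1 : ℕ) : ℝ) - (a + σ)),
      min (s - σ) (n - a - σ) ∈ Set.Icc a (n - a) := by
    rintro s ⟨hs1, hs2⟩
    exact ⟨le_min (by linarith) (by linarith), (min_le_right _ _).trans (by linarith)⟩
  refine ⟨?_, ?_, ?_, ?_⟩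
  · intro s hs
    have hm := h.mapsTo _ (key s hs)
    obtain ⟨hs1, hs2⟩ := hs
    push_cast at hs2
    have hx : max σ (s - (n - a) + σ) ≤ 1 := max_le h1 (by linarith)
    have hx' : 0 ≤ max σ (s - (n - a) + σ) := h0.trans (le_max_left _ _)
    constructor
    · intro i
      refine Fin.cases ?_ (fun j => ?_) i
      · simpa [_root_.hook] using hx'
      · simpa [_root_.hook] using hm.1 j
    · intro i
      refine Fin.cases ?_ (fun j => ?_) i
      · simpa [_root_.hook] using hx
      · simpa [_root_.hook] using hm.2 j
  · intro s hs t ht hst i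
    refine Fin.cases ?_ (fun j => ?_) i
    · simp only [_root_.hook, Fin.cons_zero]
      gcongr
    · simp only [_root_.hook, Fin.cons_succ]
      exact h.monotoneOn (key s hs) (key t ht) (by gcongr) j
  · intro s hs
    simp only [_root_.hook, Fin.sum_univ_succ, Fin.cons_zero, Fin.cons_succ]
    rw [h.sum_eq _ (key s hs)]
    rcases le_total s (n - a) with hs | hs
    · rw [max_eq_left (by linarith), min_eq_left (by linarith)]; ring
    · rw [max_eq_right (by linarith), min_eq_right (by linarith)]; ring
  · intro S hS
    -- The half-space separates the two legs. `S` may be nonmeasurable, so additivity comes from the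
    -- Carathéodory property of `H` and of the ray. Each leg is then handled by an isometry.
    set H : Set (EuclideanSpace ℝ (Fin (n + 1))) := {x | x 0 ≤ σ}
    have hH : MeasurableSet H := measurableSet_le (by fun_prop) (by fun_prop)
    set P := fun s => WithLp.toLp 2 (_root_.hook (n - a) σ γ s)
    rw [← measure_inter_add_sdiff (P '' S) hH,
      ← measure_inter_add_sdiff S (measurableSet_Iic (a := (n : ℝ) - a))]
    gcongr
    · have hsub : (fun s => s - σ) '' (S ∩ Set.Iic (n - a)) ⊆ Set.Icc a (n - a) := by
        rintro _ ⟨s, ⟨hs, hs'⟩, rfl⟩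
        have := (hS hs).1
        simp only [Set.mem_Iic] at hs'
        constructor <;> simp only <;> linarith
      have hv := h.volume_le _ hsub
      rw [← (isometry_toLp_cons_right σ).hausdorffMeasure_image (Or.inl zero_le_one)] at hv
      have hshift : volume ((fun s => s - σ) '' (S ∩ Set.Iic (n - a))) = volume (S ∩ Set.Iic (n - a)) := by
        have : (fun s => s - σ) '' (S ∩ Set.Iic (n - a)) =
            (fun s => s + σ) ⁻¹' (S ∩ Set.Iic (n - a)) := by
          simp only [sub_eq_add_neg, Set.image_add_right, neg_neg]
        rw [this, measure_preimage_add_right]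
      rw [hshift] at hv
      refine hv.trans (measure_mono ?_)
      rintro _ ⟨_, ⟨_, ⟨s, ⟨hs, hs'⟩, rfl⟩, rfl⟩, rfl⟩
      simp only [Set.mem_Iic] at hs'
      have hh0 : max σ (s - (n - a) + σ) = σ := max_eq_left (by linarith)
      refine ⟨⟨s, hs, ?_⟩, ?_⟩
      · simp only [P, _root_.hook]
        rw [hh0, min_eq_left (by linarith)]
      · show σ ≤ σ
        exact le_rfl
    · rw [← hausdorffMeasure_real,
        ← (isometry_toLp_cons_left (γ (n - a - σ)) (σ - (n - a))).hausdorffMeasure_image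
          (Or.inl zero_le_one)]
      refine measure_mono ?_
      rintro _ ⟨s, ⟨hs, hs'⟩, rfl⟩
      simp only [Set.mem_Iic, not_le] at hs'
      refine ⟨⟨s, hs, ?_⟩, ?_⟩
      · simp only [P, _root_.hook]
        rw [max_eq_right (by linarith), min_eq_right (by linarith)]
        congr 2
        ring
      · refine fun h' => absurd (show s + (σ - (n - a)) ≤ σ from h') ?_
        rw [not_le]
        linarith

theorem isSymmPath_one : IsSymmPath 1 0 (fun s _ => s) := by
  refine ⟨?_, ?_, ?_, ?_⟩
  · rintro s ⟨h0, h1⟩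
    exact ⟨fun _ => h0, fun _ => by simpa using h1⟩
  · intro s _ t _ hst _
    exact hst
  · intro s _
    simp
  · intro S _
    have : Isometry fun s : ℝ => (WithLp.toLp 2 (fun _ => s) : EuclideanSpace ℝ (Fin 1)) := by
      refine Isometry.of_dist_eq fun x x' => ?_
      simp [EuclideanSpace.dist_eq, Real.sqrt_sq_eq_abs, Real.dist_eq]
    rw [this.hausdorffMeasure_image (Or.inl zero_le_one), hausdorffMeasure_real]

theorem isSymmPath_of_lt {n : ℕ} {a : ℝ} {γ : ℝ → Fin n → ℝ} (h : n - a < a) :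
    IsSymmPath n a γ := by
  have : Set.Icc a (n - a) = ∅ := Set.Icc_eq_empty (not_le.2 h)
  refine ⟨?_, ?_, ?_, ?_⟩ <;> simp [this, MonotoneOn]

/-- Induction on dimension: each leaf and the new coordinate span a rectangle, whose hooks, labelled
by `σ`, become the new leaves. Joint measurability and `SFinite` are carried along for Tonelli in
the next step. -/
theorem exists_symmPath_foliation (n : ℕ) :
    ∃ (T : Type) (_ : MeasurableSpace T) (μ : Measure T) (a : T → ℝ)
      (γ : T → ℝ → Fin (n + 1) → ℝ), SFinite μ ∧ Measurable a ∧
      Measurable (Function.uncurry γ) ∧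
      (∀ f : (Fin (n + 1) → ℝ) → ENNReal, Measurable f → ∫⁻ x in Set.Icc 0 1, f x =
        ∫⁻ τ, (∫⁻ s in Set.Icc (a τ) ((n + 1 : ℕ) - a τ), f (γ τ s)) ∂μ) ∧
      ∀ τ, IsSymmPath (n + 1) (a τ) (γ τ) := by
  induction n with
  | zero =>
    refine ⟨Unit, inferInstance, Measure.dirac (), fun _ => 0, fun _ s _ => s, inferInstance,
      measurable_const, by fun_prop, fun f hf => ?_, fun _ => isSymmPath_one⟩
    have he := (volume_preserving_funUnique (Fin 1) ℝ).symm
    refine (he.setLIntegral_comp_preimage_emb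
      (MeasurableEquiv.measurableEmbedding _) f (Set.Icc 0 1)).symm.trans ?_
    simp only [lintegral_dirac]
    congr 2
    have : ((0 + 1 : ℕ) : ℝ) - 0 = 1 := by norm_num
    rw [this]
    ext s
    exact ⟨fun h => ⟨h.1 0, h.2 0⟩, fun h => ⟨fun _ => h.1, fun _ => h.2⟩⟩
  | succ n ih =>
    obtain ⟨T, hT, μ, a, γ, hμ, ha, hγ, hint, hpath⟩ := ih
    set V : Set (T × ℝ) := {p | 0 ≤ p.2 ∧ p.2 ≤ 1 ∧ p.2 ≤ (n + 1 : ℕ) - a p.1 - a p.1} with hVdef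
    have hV : MeasurableSet V := by
      simp only [hVdef, Set.ofPred_and]
      exact (measurableSet_le (by fun_prop) (by fun_prop)).inter
        ((measurableSet_le (by fun_prop) (by fun_prop)).inter
          (measurableSet_le (by fun_prop) (by fun_prop)))
    classical
    -- Inadmissible labels get the dummy start `n + 2`, the new dimension. Their parameter interval
    -- `[n + 2, 0]` is empty, so they contribute nothing.
    set a' : T × ℝ → ℝ := fun p => if p ∈ V then a p.1 + p.2 else n + 2 with ha'def
    have ha' : Measurable a' := Measurable.ite hV (by fun_prop) (by fun_prop)
    set γ' : T × ℝ → ℝ → Fin (n + 1 + 1) → ℝ :=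
      fun p => hook ((n + 1 : ℕ) - a p.1) p.2 (γ p.1) with hγ'def
    have hγ' : Measurable (Function.uncurry γ') := by
      refine measurable_pi_lambda _ fun i => ?_
      refine Fin.cases ?_ (fun j => ?_) i
      · simp only [Function.uncurry_def, hγ'def, hook, Fin.cons_zero]
        fun_prop
      · simp only [Function.uncurry_def, hγ'def, hook, Fin.cons_succ]
        have : Measurable fun p : (T × ℝ) × ℝ =>
            (p.1.1, min (p.2 - p.1.2) ((n + 1 : ℕ) - a p.1.1 - p.1.2)) := by fun_prop
        exact (measurable_pi_apply j).comp (hγ.comp this)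
    have hlt : ((n + 1 + 1 : ℕ) : ℝ) - ((n : ℝ) + 2) < (n : ℝ) + 2 := by
      push_cast
      have : (0 : ℝ) ≤ n := n.cast_nonneg
      linarith
    refine ⟨T × ℝ, inferInstance, μ.prod volume, a', γ', inferInstance, ha', hγ', ?_, ?_⟩
    · intro f hf
      rw [setLIntegral_Icc_cons _ hf]
      have hf' : ∀ y : ℝ, Measurable fun x : Fin (n + 1) → ℝ => f (Fin.cons y x) := fun y =>
        hf.comp (by fun_prop)
      simp_rw [fun y => hint _ (hf' y)]
      have hG : Measurable fun q : T × ℝ × ℝ => f (Fin.cons q.2.2 (γ q.1 q.2.1)) := by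
        refine hf.comp ?_
        refine measurable_pi_lambda _ fun i => ?_
        refine Fin.cases ?_ (fun j => ?_) i
        · simp only [Fin.cons_zero]
          fun_prop
        · simp only [Fin.cons_succ]
          have : Measurable fun p : T × ℝ × ℝ => (p.1, p.2.1) := by fun_prop
          exact (measurable_pi_apply j).comp (hγ.comp this)
      -- With the leaf label outermost, the rectangle identity applies leaf by leaf.
      rw [lintegral_lintegral_swap]
      swap
      · exact (measurable_setLIntegral_Icc (α := ℝ × T) (by fun_prop) (by fun_prop)
          (hG.comp (f := fun q : (ℝ × T) × ℝ => (q.1.2, q.2, q.1.1)) (by fun_prop))).aemeasurable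
      have hF : Measurable fun p : T × ℝ =>
          ∫⁻ s in Set.Icc (a' p) ((n + 1 + 1 : ℕ) - a' p), f (γ' p s) :=
        measurable_setLIntegral_Icc ha' (by fun_prop) (hf.comp hγ')
      rw [lintegral_prod _ hF.aemeasurable]
      congr 1 with τ
      rw [lintegral_rectangle_eq_lintegral_hooks (a τ) ((n + 1 : ℕ) - a τ)
        (g := fun p => f (Fin.cons p.2 (γ τ p.1)))
        (hG.comp (f := fun p : ℝ × ℝ => (τ, p)) (by fun_prop)),
        ← lintegral_indicator measurableSet_Icc]
      congr 1 with σ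
      by_cases h : (τ, σ) ∈ V
      · rw [Set.indicator_of_mem (show σ ∈ Set.Icc 0 _ from ⟨h.1, le_min h.2.1 h.2.2⟩)]
        have e1 : a' (τ, σ) = a τ + σ := if_pos h
        rw [e1]
        have e2 : ((n + 1 + 1 : ℕ) : ℝ) - (a τ + σ) = (n + 1 : ℕ) - a τ + 1 - σ := by
          push_cast
          ring
        rw [e2]
        rfl
      · rw [Set.indicator_of_notMem fun h' => h ⟨h'.1, (le_min_iff.1 h'.2).1, (le_min_iff.1 h'.2).2⟩]
        have e1 : a' (τ, σ) = n + 2 := if_neg h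
        rw [e1, Set.Icc_eq_empty (not_le.2 hlt)]
        simp
    · rintro ⟨τ, σ⟩
      by_cases h : (τ, σ) ∈ V
      · have e1 : a' (τ, σ) = a τ + σ := if_pos h
        rw [e1]
        exact (hpath τ).hook ⟨h.1, le_min h.2.1 h.2.2⟩
      · have e1 : a' (τ, σ) = n + 2 := if_neg h
        rw [e1]
        exact isSymmPath_of_lt hlt

/-! ### The upper bound, by comparison on each leaf. -/

theorem IsSymmPath.isCoordChain {n : ℕ} {a : ℝ} {γ : ℝ → Fin n → ℝ} (h : IsSymmPath n a γ) :
    IsCoordChain ((fun s => (WithLp.toLp 2 (γ s) : EuclideanSpace ℝ (Fin n))) ''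
      Set.Icc a (n - a)) := by
  rintro _ ⟨s, hs, rfl⟩ _ ⟨t, ht, rfl⟩ -
  rcases le_total s t with hst | hst
  · exact Or.inl fun i => h.monotoneOn hs ht hst i
  · exact Or.inr fun i => h.monotoneOn ht hs hst i

theorem volume_eq_lintegral_of_foliation {m : ℕ} {T : Type} [MeasurableSpace T] {μ : Measure T}
    {a : T → ℝ} {γ : T → ℝ → Fin m → ℝ} (hγ : Measurable (Function.uncurry γ))
    (hint : ∀ f : (Fin m → ℝ) → ENNReal, Measurable f → ∫⁻ x in Set.Icc 0 1, f x =
        ∫⁻ τ, (∫⁻ s in Set.Icc (a τ) (m - a τ), f (γ τ s)) ∂μ)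
    {E : Set (Fin m → ℝ)} (hE : MeasurableSet E) (hsub : E ⊆ Set.Icc 0 1) :
    volume E = ∫⁻ τ, volume (γ τ ⁻¹' E ∩ Set.Icc (a τ) (m - a τ)) ∂μ := by
  have h := hint (E.indicator 1) (measurable_one.indicator hE)
  rw [lintegral_indicator_one hE, Measure.restrict_apply hE, Set.inter_eq_left.2 hsub] at h
  rw [h]
  congr 1 with τ
  have hE' : MeasurableSet (γ τ ⁻¹' E) :=
    hE.preimage (hγ.comp (f := fun s : ℝ => (τ, s)) (by fun_prop))
  rw [← Measure.restrict_apply hE', ← lintegral_indicator_one hE']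
  rfl

theorem ofLp_mem_Icc_iff {n : ℕ} {x : EuclideanSpace ℝ (Fin n)} :
    WithLp.ofLp x ∈ Set.Icc (0 : Fin n → ℝ) 1 ↔ x ∈ unitCube n :=
  ⟨fun h i => ⟨h.1 i, h.2 i⟩, fun h => ⟨fun i => (h i).1, fun i => (h i).2⟩⟩

theorem toLp_preimage_centralSlab (n : ℕ) (κ : ℝ) :
    WithLp.toLp 2 ⁻¹' centralSlab n κ = {x : Fin n → ℝ | x ∈ Set.Icc 0 1 ∧
      ((n : ℝ) - κ) / 2 ≤ ∑ i, x i ∧ ∑ i, x i ≤ ((n : ℝ) + κ) / 2} := by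
  ext x
  exact and_congr_left' ofLp_mem_Icc_iff.symm

theorem measurableSet_centralSlab (n : ℕ) (κ : ℝ) : MeasurableSet (centralSlab n κ) := by
  have : centralSlab n κ = WithLp.ofLp ⁻¹' {x : Fin n → ℝ | x ∈ Set.Icc 0 1 ∧
      ((n : ℝ) - κ) / 2 ≤ ∑ i, x i ∧ ∑ i, x i ≤ ((n : ℝ) + κ) / 2} := by
    rw [← toLp_preimage_centralSlab]
    rfl
  rw [this]
  refine MeasurableSet.preimage ?_ (by fun_prop)
  simp only [Set.ofPred_and]
  exact measurableSet_Icc.inter ((measurableSet_le (by fun_prop) (by fun_prop)).inter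
    (measurableSet_le (by fun_prop) (by fun_prop)))

theorem volume_le_volume_centralSlab {m : ℕ} {κ : ℝ}
    {A : Set (EuclideanSpace ℝ (Fin (m + 1)))} (hA : IsContSperner (m + 1) κ A) :
    volume A ≤ volume (centralSlab (m + 1) κ) := by
  -- The disintegration needs a Borel set; a subset of `A` keeps the chain condition.
  obtain ⟨B, hBA, hB, hBae⟩ := hA.measurable.exists_measurable_subset_ae_eq
  rw [← measure_congr hBae]
  obtain ⟨T, _, μ, a, γ, _, -, hγ, hint, hpath⟩ := exists_symmPath_foliation m
  have hp := PiLp.volume_preserving_toLp (Fin (m + 1))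
  have hS := measurableSet_centralSlab (m + 1) κ
  rw [← hp.measure_preimage hB.nullMeasurableSet, ← hp.measure_preimage hS.nullMeasurableSet,
    volume_eq_lintegral_of_foliation hγ hint (hB.preimage hp.measurable)
      fun x hx => ofLp_mem_Icc_iff.2 (hA.subset_unitCube (hBA hx)),
    volume_eq_lintegral_of_foliation hγ hint (hS.preimage hp.measurable)
      fun x hx => ofLp_mem_Icc_iff.2 hx.1]
  refine lintegral_mono fun τ => ?_
  set I := Set.Icc (a τ) ((m + 1 : ℕ) - a τ)
  have hslab : Set.Icc (((m + 1 : ℕ) - κ) / 2) (((m + 1 : ℕ) + κ) / 2) ∩ I ⊆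
      γ τ ⁻¹' (WithLp.toLp 2 ⁻¹' centralSlab (m + 1) κ) ∩ I := by
    rintro s ⟨hs, hsI⟩
    refine ⟨?_, hsI⟩
    rw [toLp_preimage_centralSlab]
    refine ⟨(hpath τ).mapsTo s hsI, ?_⟩
    rw [(hpath τ).sum_eq s hsI]
    exact hs
  refine le_trans ?_ (measure_mono hslab)
  rw [Set.Icc_inter_Icc, Real.volume_Icc]
  have h1 : volume (γ τ ⁻¹' (WithLp.toLp 2 ⁻¹' B) ∩ I) ≤ ENNReal.ofReal κ := by
    refine ((hpath τ).volume_le _ Set.inter_subset_right).trans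
      (le_trans (measure_mono ?_) (hA.chain_le _ ?_ (hpath τ).isCoordChain))
    · rintro _ ⟨s, ⟨hsB, hsI⟩, rfl⟩
      exact ⟨hBA hsB, s, hsI, rfl⟩
    · rintro _ ⟨s, hs, rfl⟩
      exact ofLp_mem_Icc_iff.1 ((hpath τ).mapsTo s hs)
  have h2 : volume (γ τ ⁻¹' (WithLp.toLp 2 ⁻¹' B) ∩ I) ≤
      ENNReal.ofReal ((m + 1 : ℕ) - a τ - a τ) :=
    (measure_mono Set.inter_subset_right).trans_eq Real.volume_Icc
  -- Both intervals have midpoint `(m + 1) / 2`, so the intersection has the smaller of their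
  -- lengths, `κ` and `m + 1 - 2 * a τ`.
  simp only [max_def, min_def]
  split_ifs with h3 h4 h4
  · exact h2.trans (ENNReal.ofReal_le_ofReal (by linarith))
  · exact h1.trans (ENNReal.ofReal_le_ofReal (by linarith))
  · exact h2.trans (ENNReal.ofReal_le_ofReal (by linarith))
  · exact h1.trans (ENNReal.ofReal_le_ofReal (by linarith))

/-! ### Admissibility of the slab. -/

theorem dist_le_sum_sub_of_le {n : ℕ} {x y : EuclideanSpace ℝ (Fin n)} (h : ∀ i, x i ≤ y i) :
    dist x y ≤ ∑ i, y i - ∑ i, x i := by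
  rw [EuclideanSpace.dist_eq, ← Finset.sum_sub_distrib]
  have h0 : 0 ≤ ∑ i, (y i - x i) := Finset.sum_nonneg fun i _ => sub_nonneg.2 (h i)
  refine Real.sqrt_le_iff.2 ⟨h0, ?_⟩
  have := Finset.sum_sq_le_sq_sum_of_nonneg (s := Finset.univ) (f := fun i => y i - x i)
    fun i _ => sub_nonneg.2 (h i)
  refine le_trans (le_of_eq (Finset.sum_congr rfl fun i _ => ?_)) this
  rw [Real.dist_eq, sq_abs]
  ring

theorem IsCoordChain.dist_le {n : ℕ} {C : Set (EuclideanSpace ℝ (Fin n))} (hC : IsCoordChain C)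
    {x y : EuclideanSpace ℝ (Fin n)} (hx : x ∈ C) (hy : y ∈ C) :
    dist x y ≤ dist (∑ i, x i) (∑ i, y i) := by
  rcases eq_or_ne x y with rfl | hne
  · simp
  rcases hC hx hy hne with h | h
  · rw [dist_comm (∑ i, x i), Real.dist_eq]
    exact (dist_le_sum_sub_of_le h).trans (le_abs_self _)
  · rw [dist_comm x, Real.dist_eq]
    exact (dist_le_sum_sub_of_le h).trans (le_abs_self _)

/-- On a chain, Euclidean distance is at most the difference of coordinate sums, so the sum is
injective with 1-Lipschitz inverse. Lipschitz maps control outer measure, so `C` need not be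
measurable. -/
theorem IsCoordChain.hausdorffMeasure_le {n : ℕ} {C : Set (EuclideanSpace ℝ (Fin n))}
    (hC : IsCoordChain C) :
    Measure.hausdorffMeasure 1 C ≤ volume ((fun x => ∑ i, x i) '' C) := by
  set φ : EuclideanSpace ℝ (Fin n) → ℝ := fun x => ∑ i, x i
  have hinj : Set.InjOn φ C := by
    intro x hx y hy hxy
    have := hC.dist_le hx hy
    rw [show ∑ i, x i = ∑ i, y i from hxy, dist_self] at this
    exact dist_le_zero.1 this
  have hleft := hinj.leftInvOn_invFunOn
  have hLip : LipschitzOnWith 1 (Function.invFunOn φ C) (φ '' C) := by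
    refine LipschitzOnWith.of_dist_le_mul ?_
    rintro _ ⟨x, hx, rfl⟩ _ ⟨y, hy, rfl⟩
    rw [hleft hx, hleft hy, NNReal.coe_one, one_mul]
    exact hC.dist_le hx hy
  have h := hLip.hausdorffMeasure_image_le zero_le_one
  rw [hleft.image_image, hausdorffMeasure_real] at h
  simpa using h

theorem isContSperner_centralSlab (n : ℕ) (κ : ℝ) : IsContSperner n κ (centralSlab n κ) := by
  refine ⟨fun x hx => hx.1, (measurableSet_centralSlab n κ).nullMeasurableSet, fun C _ hC => ?_⟩
  refine (IsCoordChain.hausdorffMeasure_le (hC.mono Set.inter_subset_right)).trans ?_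
  have : (fun x : EuclideanSpace ℝ (Fin n) => ∑ i, x i) '' (centralSlab n κ ∩ C) ⊆
      Set.Icc (((n : ℝ) - κ) / 2) (((n : ℝ) + κ) / 2) := by
    rintro _ ⟨x, ⟨hx, -⟩, rfl⟩
    exact hx.2
  refine (measure_mono this).trans ?_
  rw [Real.volume_Icc]
  exact ENNReal.ofReal_le_ofReal (by linarith)

/-! ### The volume of the slab. -/

/-- The truncated power `t₊ ^ n`, with value `0` at `t = 0` for every `n`. -/
noncomputable def truncPow (n : ℕ) (t : ℝ) : ℝ := if 0 < t then t ^ n else 0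

/-- The distribution function of a sum of `n` independent uniform variables on `[0,1]`. -/
noncomputable def irwinHall (n : ℕ) (t : ℝ) : ℝ :=
  (∑ j ∈ Finset.range (n + 1), (-1 : ℝ) ^ j * (n.choose j : ℝ) * truncPow n (t - j)) /
    (n.factorial : ℝ)

theorem truncPow_succ (n : ℕ) (t : ℝ) : truncPow (n + 1) t = (max t 0) ^ (n + 1) := by
  unfold truncPow
  split_ifs with h
  · rw [max_eq_left h.le]
  · rw [max_eq_right (not_lt.1 h), zero_pow (by omega)]

theorem monotone_truncPow (n : ℕ) : Monotone (truncPow n) := by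
  intro s t hst
  unfold truncPow
  split_ifs with h1 h2
  · gcongr
  · exact absurd (h1.trans_le hst) h2
  · positivity
  · exact le_rfl

theorem integral_truncPow (n : ℕ) (t c : ℝ) :
    ∫ u in (t - 1)..t, truncPow n (u - c) =
      (truncPow (n + 1) (t - c) - truncPow (n + 1) (t - (c + 1))) / (n + 1) := by
  rw [intervalIntegral.integral_comp_sub_right (fun u => truncPow n u)]
  have hcont : Continuous fun u => truncPow (n + 1) u / (n + 1) := by
    simp only [truncPow_succ]
    fun_prop
  -- The antiderivative may fail to be differentiable at `0` when `n = 0`; a countable exceptional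
  -- set is harmless.
  rw [integral_eq_of_hasDerivAt_off_countable (fun u => truncPow (n + 1) u / (n + 1)) _
    (Set.countable_singleton 0) hcont.continuousOn _ (monotone_truncPow n).intervalIntegrable]
  · rw [← sub_div]
    rw [show t - 1 - c = t - (c + 1) by ring]
  · rintro u ⟨-, hu⟩
    rcases lt_or_gt_of_ne (show u ≠ 0 from hu) with h | h
    · have : (fun u => truncPow (n + 1) u / ((n : ℝ) + 1)) =ᶠ[nhds u] fun _ => 0 := by
        filter_upwards [gt_mem_nhds h] with v hv
        simp [truncPow, not_lt.2 (le_of_lt hv)]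
      rw [show truncPow n u = 0 from if_neg (not_lt.2 h.le)]
      exact (hasDerivAt_const u (0 : ℝ)).congr_of_eventuallyEq this
    · have : (fun u => truncPow (n + 1) u / ((n : ℝ) + 1)) =ᶠ[nhds u]
          fun v => v ^ (n + 1) / ((n : ℝ) + 1) := by
        filter_upwards [lt_mem_nhds h] with v hv
        simp [truncPow, hv]
      rw [show truncPow n u = u ^ n from if_pos h]
      refine HasDerivAt.congr_of_eventuallyEq ?_ this
      have hd := (hasDerivAt_pow (n + 1) u).div_const ((n : ℝ) + 1)
      refine hd.congr_deriv ?_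
      have : (n : ℝ) + 1 ≠ 0 := by positivity
      push_cast
      rw [mul_div_right_comm, div_self this, one_mul]

theorem intervalIntegrable_truncPow_sub (n : ℕ) (a b c : ℝ) :
    IntervalIntegrable (fun u => truncPow n (u - c)) volume a b :=
  Monotone.intervalIntegrable fun _ _ h => monotone_truncPow n (by linarith)

theorem intervalIntegrable_irwinHall (n : ℕ) (a b : ℝ) :
    IntervalIntegrable (irwinHall n) volume a b := by
  have h := IntervalIntegrable.sum (Finset.range (n + 1)) fun j _ =>
    (intervalIntegrable_truncPow_sub n a b j).const_mul ((-1 : ℝ) ^ j * (n.choose j : ℝ))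
  convert h.div_const (n.factorial : ℝ) using 1
  ext t
  simp [irwinHall]

/-- Integrating over a unit window gives differences of consecutive truncated powers, which Pascal's
rule recombines. -/
theorem integral_irwinHall (n : ℕ) (t : ℝ) :
    ∫ u in (t - 1)..t, irwinHall n u = irwinHall (n + 1) t := by
  unfold irwinHall
  rw [intervalIntegral.integral_div, intervalIntegral.integral_finsetSum fun (j : ℕ) _ =>
    (intervalIntegrable_truncPow_sub n (t - 1) t j).const_mul ((-1 : ℝ) ^ j * (n.choose j : ℝ))]
  simp only [intervalIntegral.integral_const_mul, integral_truncPow]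
  have hn : (n : ℝ) + 1 ≠ 0 := by positivity
  have hf : (n.factorial : ℝ) ≠ 0 := by positivity
  have key : ∑ j ∈ Finset.range (n + 1), (-1 : ℝ) ^ j * (n.choose j : ℝ) *
      (truncPow (n + 1) (t - j) - truncPow (n + 1) (t - (j + 1))) =
      ∑ j ∈ Finset.range (n + 1 + 1), (-1 : ℝ) ^ j * ((n + 1).choose j : ℝ) *
        truncPow (n + 1) (t - j) := by
    -- The added term `j = n + 1` vanishes since `n.choose (n + 1) = 0`.
    have h1 : ∑ j ∈ Finset.range (n + 1), (-1 : ℝ) ^ j * (n.choose j : ℝ) *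
        truncPow (n + 1) (t - j) = ∑ j ∈ Finset.range (n + 1 + 1), (-1 : ℝ) ^ j *
          (n.choose j : ℝ) * truncPow (n + 1) (t - j) := by
      rw [Finset.sum_range_succ _ (n + 1)]
      simp
    simp only [mul_sub, Finset.sum_sub_distrib]
    rw [h1, Finset.sum_range_succ', Finset.sum_range_succ' _ (n + 1), add_sub_right_comm,
      ← Finset.sum_sub_distrib]
    congr 1
    · refine Finset.sum_congr rfl fun j _ => ?_
      rw [Nat.choose_succ_succ]
      push_cast
      ring
    · simp
  rw [← key, Nat.factorial_succ, Finset.sum_div, Finset.sum_div]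
  refine Finset.sum_congr rfl fun j _ => ?_
  push_cast
  field_simp

theorem measurableSet_cube_sum_lt (n : ℕ) (t : ℝ) :
    MeasurableSet {x : Fin n → ℝ | x ∈ Set.Icc 0 1 ∧ ∑ i, x i < t} := by
  rw [Set.ofPred_and]
  exact measurableSet_Icc.inter (measurableSet_lt (by fun_prop) (by fun_prop))

theorem volume_cube_sum_lt_lt_top (n : ℕ) (t : ℝ) :
    volume {x : Fin n → ℝ | x ∈ Set.Icc 0 1 ∧ ∑ i, x i < t} < ⊤ :=
  (measure_mono fun _ hx => hx.1).trans_lt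
    (isCompact_Icc (a := (0 : Fin n → ℝ)) (b := 1)).measure_lt_top

theorem volume_real_cube_sum_lt (n : ℕ) (t : ℝ) :
    volume.real {x : Fin n → ℝ | x ∈ Set.Icc 0 1 ∧ ∑ i, x i < t} = irwinHall n t := by
  induction n generalizing t with
  | zero =>
    -- The strict inequality on the empty sum matches the convention `truncPow 0 0 = 0`.
    by_cases h : 0 < t
    · have : {x : Fin 0 → ℝ | x ∈ Set.Icc 0 1 ∧ ∑ i, x i < t} = Set.univ := by
        ext x
        simp [h]
      rw [this, volume_pi, Measure.pi_of_empty]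
      simp [irwinHall, truncPow, h, Measure.real]
    · simp [irwinHall, truncPow, h, Measure.real]
  | succ n ih =>
    -- Fixing the first coordinate `y` leaves the threshold `t - y`; as `y` runs over `[0,1]`, this
    -- is the unit window of `integral_irwinHall`.
    have hslice : volume {x : Fin (n + 1) → ℝ | x ∈ Set.Icc 0 1 ∧ ∑ i, x i < t} =
        ∫⁻ y in Set.Icc (0 : ℝ) 1,
          volume {x : Fin n → ℝ | x ∈ Set.Icc 0 1 ∧ ∑ i, x i < t - y} := by
      have hS : MeasurableSet {x : Fin (n + 1) → ℝ | ∑ i, x i < t} :=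
        measurableSet_lt (by fun_prop) (by fun_prop)
      have e : ∀ (m : ℕ) (r : ℝ), volume {x : Fin m → ℝ | x ∈ Set.Icc 0 1 ∧ ∑ i, x i < r} =
          ∫⁻ x in Set.Icc 0 1, {x : Fin m → ℝ | ∑ i, x i < r}.indicator 1 x := by
        intro m r
        have hS : MeasurableSet {x : Fin m → ℝ | ∑ i, x i < r} :=
          measurableSet_lt (by fun_prop) (by fun_prop)
        rw [lintegral_indicator_one hS, Measure.restrict_apply hS, Set.inter_comm]
        rfl
      simp only [e]
      rw [setLIntegral_Icc_cons _ (measurable_one.indicator hS)]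
      congr 1 with y
      congr 1 with x
      simp only [Set.indicator_apply, Set.mem_ofPred_eq, Fin.sum_univ_succ, Fin.cons_zero,
        Fin.cons_succ, lt_sub_iff_add_lt']
      rfl
    have hint : IntegrableOn (fun y => irwinHall n (t - y)) (Set.Icc (0 : ℝ) 1) := by
      rw [← intervalIntegrable_iff_integrableOn_Icc_of_le zero_le_one]
      simpa using (intervalIntegrable_irwinHall n t (t - 1)).comp_sub_left t
    have hval : ∀ s, volume {x : Fin n → ℝ | x ∈ Set.Icc 0 1 ∧ ∑ i, x i < s} =
        ENNReal.ofReal (irwinHall n s) := fun s => by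
      rw [← ih, ofReal_measureReal (volume_cube_sum_lt_lt_top n s).ne]
    rw [Measure.real, hslice]
    simp only [hval]
    rw [← ofReal_integral_eq_lintegral_ofReal hint
      (Filter.Eventually.of_forall fun y => by simp only [← ih]; exact measureReal_nonneg),
      ENNReal.toReal_ofReal (integral_nonneg fun y => by simp only [← ih]; exact measureReal_nonneg),
      integral_Icc_eq_integral_Ioc, ← intervalIntegral.integral_of_le zero_le_one,
      intervalIntegral.integral_comp_sub_left (fun u => irwinHall n u), sub_zero,
      integral_irwinHall]

theorem volume_real_cube_lt_sum (n : ℕ) (t : ℝ) :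
    volume.real {x : Fin n → ℝ | x ∈ Set.Icc 0 1 ∧ n - t < ∑ i, x i} = irwinHall n t := by
  have hrefl := Measure.measurePreserving_sub_left (volume : Measure (Fin n → ℝ)) 1
  rw [← volume_real_cube_sum_lt, Measure.real, Measure.real, ← hrefl.measure_preimage
      (measurableSet_cube_sum_lt n t).nullMeasurableSet]
  congr 2
  ext x
  refine and_congr ⟨fun h => ⟨fun i => ?_, fun i => ?_⟩, fun h => ⟨fun i => ?_, fun i => ?_⟩⟩ ?_
  · simpa using h.2 i
  · simpa using h.1 i
  · simpa using h.2 i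
  · simpa using h.1 i
  · simp only [Pi.sub_apply, Pi.one_apply, Finset.sum_sub_distrib, Finset.sum_const,
      Finset.card_univ, Fintype.card_fin, nsmul_eq_mul, mul_one]
    constructor <;> intro h <;> linarith

theorem volume_real_centralSlab {n : ℕ} {κ : ℝ} (hκ : 0 < κ) :
    volume.real (centralSlab n κ) = 1 - 2 * irwinHall n ((n - κ) / 2) := by
  set t := ((n : ℝ) - κ) / 2
  have hp := PiLp.volume_preserving_toLp (Fin n)
  rw [Measure.real, ← hp.measure_preimage (measurableSet_centralSlab n κ).nullMeasurableSet,
    ← Measure.real]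
  set Lo := {x : Fin n → ℝ | x ∈ Set.Icc 0 1 ∧ ∑ i, x i < t}
  set Up := {x : Fin n → ℝ | x ∈ Set.Icc 0 1 ∧ n - t < ∑ i, x i} with hUp
  have hLom : MeasurableSet Lo := measurableSet_cube_sum_lt n t
  have hUpm : MeasurableSet Up := by
    rw [hUp, Set.ofPred_and]
    exact measurableSet_Icc.inter (measurableSet_lt (by fun_prop) (by fun_prop))
  have hcube : volume (Set.Icc (0 : Fin n → ℝ) 1) = 1 := by
    simp [Real.volume_Icc_pi]
  -- Positivity of `κ` gives `t < n - t`.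
  have hdisj : Disjoint Lo Up := by
    refine Set.disjoint_left.2 fun x hx hx' => ?_
    have h1 : ∑ i, x i < t := hx.2
    have h2 : n - t < ∑ i, x i := hx'.2
    simp only [t] at h1 h2
    linarith
  have hsub : Lo ∪ Up ⊆ Set.Icc 0 1 := Set.union_subset (fun _ h => h.1) fun _ h => h.1
  have hset : WithLp.toLp 2 ⁻¹' centralSlab n κ = Set.Icc (0 : Fin n → ℝ) 1 \ (Lo ∪ Up) := by
    rw [toLp_preimage_centralSlab]
    ext x
    have ht : (n : ℝ) - t = (n + κ) / 2 := by simp only [t]; ring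
    constructor
    · rintro ⟨hx, h1, h2⟩
      refine ⟨hx, ?_⟩
      rintro (h | h)
      · exact absurd h.2 (not_lt.2 h1)
      · exact absurd h.2 (not_lt.2 (ht ▸ h2))
    · rintro ⟨hx, h⟩
      refine ⟨hx, not_lt.1 fun h' => h (Or.inl ⟨hx, h'⟩), not_lt.1 fun h' => h (Or.inr ⟨hx, ?_⟩)⟩
      rwa [ht]
  have hfin : ∀ s ⊆ Set.Icc (0 : Fin n → ℝ) 1, volume s ≠ ⊤ := fun s hs =>
    ((measure_mono hs).trans_lt (hcube ▸ ENNReal.one_lt_top)).ne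
  rw [hset, measureReal_sdiff hsub (hLom.union hUpm) (hfin _ subset_rfl),
    measureReal_union hdisj hUpm (hfin _ fun _ h => h.1) (hfin _ fun _ h => h.1),
    volume_real_cube_lt_sum, volume_real_cube_sum_lt, Measure.real, hcube]
  simp only [ENNReal.toReal_one]
  ring

theorem irwinHall_eq_sum_floor {n : ℕ} (hn : n ≠ 0) {t : ℝ} (ht : 0 ≤ t) (htn : t ≤ n) :
    irwinHall n t = (∑ j ∈ Finset.range (⌊t⌋₊ + 1),
      (-1 : ℝ) ^ j * (n.choose j : ℝ) * (t - j) ^ n) / (n.factorial : ℝ) := by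
  unfold irwinHall
  congr 1
  have hle : ⌊t⌋₊ ≤ n := Nat.floor_le_of_le htn
  rw [← Finset.sum_subset (Finset.range_mono (Nat.succ_le_succ hle))]
  · refine Finset.sum_congr rfl fun j hj => ?_
    have hj' : (j : ℝ) ≤ t :=
      (Nat.cast_le.2 (Nat.lt_succ_iff.1 (Finset.mem_range.1 hj))).trans (Nat.floor_le ht)
    congr 1
    unfold truncPow
    split_ifs with h
    · rfl
    -- If `t = j`, the sum up to the floor contains the term `0 ^ n`, which vanishes only because `n
    -- ≠ 0`.
    · rw [show t - j = 0 by linarith, zero_pow hn]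
  · intro j _ hj
    have hj' : t < j := (Nat.floor_lt ht).1 (by simpa using hj)
    rw [truncPow, if_neg (by linarith), mul_zero]

theorem theorem3 (n : ℕ) (κ : ℝ) (hκ_pos : 0 < κ) (hκ_le : κ ≤ (n : ℝ)) :
    (∀ A : Set (EuclideanSpace ℝ (Fin n)), IsContSperner n κ A →
      volume A ≤ volume (centralSlab n κ)) ∧
    IsContSperner n κ (centralSlab n κ) ∧
    volume.real (centralSlab n κ) = slabVolume n κ := by
  have hn : n ≠ 0 := by
    rintro rfl
    simp only [Nat.cast_zero] at hκ_le
    linarith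
  obtain ⟨m, rfl⟩ := Nat.exists_eq_succ_of_ne_zero hn
  refine ⟨fun A hA => volume_le_volume_centralSlab hA, isContSperner_centralSlab _ _, ?_⟩
  rw [volume_real_centralSlab hκ_pos, irwinHall_eq_sum_floor hn (by linarith) (by linarith),
    slabVolume]
  ring
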